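/- **Theorem B.** Let $n\ge 1$, let $T_n$ be the complete binary rooted tree of height $n$ with leaves $1,\dots,2^n$ numbered from left to right, and let $W_n=\mathrm{Aut}(T_n)$, viewed as a group of permutations of the leaves (composed from right to left). For $1\le i\le n$ let $a_i=\prod_{j=1}^{2^{i-1}}(j,\,j+2^{i-1})\in W_n$ and, for $0\le i\le n$, $x_i=a_1a_2\cdots a_i$. Put $v_i=x_{i+2}^2$ for $0\le i\le n-3$, and $m_1=\mathrm{id}$, $m_n=a_{n-1}x_{n-2}^{x_n}$ for $n\ge 2$, where $g^h=hgh^{-1}$ (so $m_2=(1,2)$). Let $$M_n=\langle x_n,\,m_n,\,v_{n-3},\dots,v_0\rangle\le W_n$$ (so $M_1=\langle(1,2)\rangle$ and $M_2=\langle(1,3,2,4),(1,2)\rangle$). A *datum* of level $n$ is a pair $\bigl(\prod_i[t_i,d_i],r\bigr)$ consisting of a formal commutative product of symbols $[t_i,d_i]$ with types $t_i\in\{nn,ns,sn,ss\}$ and degrees $d_i\geq 1$ with $\sum_i d_i=2^n$, and a density $r\in[0,1]$. *Model 3* has the level $1$ data $$([nn,2],\tfrac14),\quad([ss,2],\tfrac14),\quad([nn,1][nn,1],\tfrac18),\quad([ss,1][ss,1],\tfrac18),\quad([ns,1][sn,1],\tfrac14),$$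 and its level $n+1$ data arise from its level $n$ data by replacing, in each datum, all factors independently of each other according to the transitions $$[nn,d]\to[nn,2d],\qquad [ns,d]\to[ss,2d],\qquad [sn,d]\to[nn,d][ss,d],\qquad [ss,d]\to[nn,d][nn,d]\ \text{or}\ [ss,d][ss,d],$$ where the two alternatives for $[ss,d]$ have probability $\tfrac12$ each; the density of a datum is multiplied by the probabilities of the transitions made. The level $n$ *cycle data* of Model 3 is the set of pairs $(c,q)$, where $c$ is a partition of $2^n$ that occurs as the multiset of degrees of some level $n$ datum and $q$ is the sum of the densities of all level $n$ data with this multiset of degrees. The *cycle data* of $M_n$ is the set of pairs $(c,q)$, where $c$ is the cycle type ($1$-cycles included) of some element of $M_n$ and $q$ is the proportion of elements of $M_n$ with cycle type $c$. Then, for every $n\ge 1$, the cycle data of $M_n$ equals the level $n$ cycle data of Model 3. -/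

import Mathlib

namespace MarkovModel

noncomputable section

open Equiv

/-! ### The tree and its automorphism group -/

/-- `Aut(T_n)` in its faithful action on the `2 ^ n` leaves of the complete binary rooted tree `T_n`
of height `n`. The leaves are `0, …, 2 ^ n - 1` from left to right, and `i`, `j` have the same
ancestor `k` levels above them iff `i / 2 ^ k = j / 2 ^ k`. -/
def treeAut (n : ℕ) : Subgroup (Perm (Fin (2 ^ n))) where
  carrier := {g | ∀ (k : ℕ) (i j : Fin (2 ^ n)),
    (g i : ℕ) / 2 ^ k = (g j : ℕ) / 2 ^ k ↔ (i : ℕ) / 2 ^ k = (j : ℕ) / 2 ^ k}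
  one_mem' := fun _ _ _ => Iff.rfl
  mul_mem' := fun hg hh k i j => (hg k _ _).trans (hh k i j)
  inv_mem' := fun {g} hg k i j => by simpa using (hg k (g⁻¹ i) (g⁻¹ j)).symm

/-- Exchange `[0, h)` with `[h, 2h)` by translation by `h`, and fix everything else. -/
def swapHalves (h j : ℕ) : ℕ :=
  if j < h then j + h else if j < 2 * h then j - h else j

theorem swapHalves_swapHalves (h j : ℕ) : swapHalves h (swapHalves h j) = j := by
  unfold swapHalves; split_ifs <;> omega

theorem swapHalves_lt {n i j : ℕ} (hi : i < n) (hj : j < 2 ^ n) : swapHalves (2 ^ i) j < 2 ^ n := by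
  have h : 2 * 2 ^ i ≤ 2 ^ n := by
    rw [← pow_succ']; exact Nat.pow_le_pow_right (by norm_num) hi
  unfold swapHalves; split_ifs <;> omega

/-- The generator `a_i`, `1 ≤ i ≤ n`, of `Aut(T_n)`: the product of the transpositions
`(j, j + 2 ^ (i - 1))` over the first `2 ^ (i - 1)` leaves `j`. (The value is `1` for other `i`.) -/
def a (n i : ℕ) : Perm (Fin (2 ^ n)) :=
  if hi : 1 ≤ i ∧ i ≤ n then
    Function.Involutive.toPerm
      (fun j => ⟨swapHalves (2 ^ (i - 1)) j, swapHalves_lt (by omega) j.isLt⟩)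
      (fun j => Fin.ext (swapHalves_swapHalves (2 ^ (i - 1)) j))
  else 1

/-- `x_i = a_1 a_2 ⋯ a_i` (the standard `i`-odometer), regarded as an element of `Aut(T_n)`;
products of permutations are composed from right to left. -/
def x (n i : ℕ) : Perm (Fin (2 ^ n)) :=
  ((List.range i).map fun k => a n (k + 1)).prod

/-- `m_1 = id` and `m_n = a_{n-1} x_{n-2}^{x_n}` for `n ≥ 2`, where `g ^ h = h g h⁻¹`.
As `x_0 = id`, this gives `m_2 = a_1`. -/
def m : (n : ℕ) → Perm (Fin (2 ^ n))
  | 0 => 1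
  | 1 => 1
  | n + 2 => a (n + 2) (n + 1) * (x (n + 2) (n + 2) * x (n + 2) n * (x (n + 2) (n + 2))⁻¹)

/-- `v_i = x_{i+2}²`, regarded as an element of `Aut(T_n)`. -/
def v (n i : ℕ) : Perm (Fin (2 ^ n)) := x n (i + 2) ^ 2

/-- `M_n = ⟨x_n, m_n, v_{n-3}, …, v_0⟩`. -/
def M (n : ℕ) : Subgroup (Perm (Fin (2 ^ n))) :=
  Subgroup.closure ({x n n, m n} ∪ {g | ∃ i, i + 3 ≤ n ∧ g = v n i})

/-! ### Cycle data -/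

/-- The cycle type of a permutation, `1`-cycles included. -/
def cycles {n : ℕ} (g : Perm (Fin (2 ^ n))) : Multiset ℕ := g.partition.parts

/-- The cycle data of `S₁` relative to `S₂`: all pairs `(c, p_c |S₁| / |S₂|)`, where `c` is a cycle
type that occurs in `S₁` and `p_c` is the proportion of elements of `S₁` of cycle type `c`. -/
def cycleData {n : ℕ} (S₁ S₂ : Set (Perm (Fin (2 ^ n)))) : Set (Multiset ℕ × ℚ) :=
  {p | ∃ g ∈ S₁, p.1 = cycles g ∧
    p.2 = ({h ∈ S₁ | cycles h = cycles g}.ncard / S₁.ncard : ℚ) * (S₁.ncard / S₂.ncard : ℚ)}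

/-! ### The Markov process of Model 3 -/

/-- The types `nn`, `ns`, `sn`, `ss`. -/
inductive FactorType
  | nn | ns | sn | ss

/-- A formal factor `[t, d]`: a type `t` and a degree `d`. -/
abbrev Factor := FactorType × ℕ

/-- A formal (commutative) product `∏ [t_i, d_i]`. -/
abbrev FormalProduct := Multiset Factor

/-- A collection of data `(F, r)`, where data with the same formal product are combined:
a finitely supported assignment of densities to formal products. Data are written
`single F r`, and `single F r * single G s = single (F + G) (r * s)`: juxtaposition of formal
products, with densities multiplied, so that products describe independent choices. -/
abbrev LevelData := AddMonoidAlgebra ℚ FormalProduct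

/-- The possible results of one transition from a single factor. -/
def transitions : Factor → List FormalProduct
  | (.nn, d) => [{(.nn, 2 * d)}]
  | (.ns, d) => [{(.ss, 2 * d)}]
  | (.sn, d) => [{(.nn, d), (.ss, d)}]
  | (.ss, d) => [{(.nn, d), (.nn, d)}, {(.ss, d), (.ss, d)}]

/-- One transition from a single factor: all possible results are equiprobable. -/
def stepFactor (f : Factor) : LevelData :=
  ((transitions f).map fun F =>
    AddMonoidAlgebra.single F (1 / ((transitions f).length : ℚ))).sum

/-- One application of the Markov process: in each datum `(F, r)` the factors of `F` make their
transitions independently of each other. -/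
def step (D : LevelData) : LevelData :=
  D.coeff.sum fun F r => r • (F.map stepFactor).prod

/-- The level `1` data of Model 3. -/
def levelOne : LevelData :=
  .single {(.nn, 2)} (1 / 4) + .single {(.ss, 2)} (1 / 4) +
    .single {(.nn, 1), (.nn, 1)} (1 / 8) + .single {(.ss, 1), (.ss, 1)} (1 / 8) +
    .single {(.ns, 1), (.sn, 1)} (1 / 4)

/-- The level `n` data of Model 3, for `n ≥ 1`. -/
def levelData (n : ℕ) : LevelData := step^[n - 1] levelOne

/-- The partition underlying a formal product. -/
def degrees (F : FormalProduct) : Multiset ℕ := F.map Prod.snd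

/-- The cycle data of a collection of data: the partitions that occur, each with the sum of the
densities of all data with that partition. -/
def LevelData.toCycleData (D : LevelData) : Set (Multiset ℕ × ℚ) :=
  {p | ∃ F ∈ D.coeff.support, p.1 = degrees F ∧
    p.2 = ∑ G ∈ D.coeff.support with degrees G = degrees F, D.coeff G}

end

end MarkovModel

/-!
Identify a distribution of permutations of the leaves of `T_n` with an element of the rational group
algebra. Since `Aut(T_{n+1})` is the wreath product of `Aut(T_n)` with the exchange of the two
halves, one can define distributions `nn`, `ns`, `sn`, `ss` of level `n + 1` as combinations of
products of two of them of level `n`, possibly followed by the exchange. They multiply like the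
Klein four-group, with `x_n` acting as `nn`, `a_n` as `ns` and the `v_i` as `ss`. Because
`x_{n+1} = (x_n, 1) a_{n+1}`, `m_{n+1} = (a_n, x_n a_n)` and `v_i = (v_i, 1)`, a suitable
combination of such products is invariant under left multiplication by the generators of `M_{n+1}`;
as it is supported in `M_{n+1}` and has total mass `1`, it is the uniform distribution there.

A product `(g, h)` has the cycles of `g` and those of `h`, whereas `(g, h) a_{n+1}` has those of
`g h` with doubled lengths. On the generating functions of cycle types, the recursion for the four
distributions therefore becomes the transition rule of Model 3, and the combination for `M_{n+1}`
becomes the level `1` data.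
-/

namespace MarkovModel

noncomputable section

open Equiv

/-! ### Cycle types and minimal periods -/

section CycleType

open Function Finset

variable {α β : Type*}

theorem minimalPeriod_eq_of_semiconj {f : α → α} {g : β → β} {φ : α → β} (hφ : Injective φ)
    (h : Semiconj φ f g) (y : α) : minimalPeriod g (φ y) = minimalPeriod f y := by
  rw [minimalPeriod_eq_minimalPeriod_iff]
  intro k
  rw [IsPeriodicPt, IsPeriodicPt, IsFixedPt, IsFixedPt, ← (h.iterate_right k).eq, hφ.eq_iff]

theorem two_dvd_minimalPeriod_sumCongr_mul_sumComm (g h : Perm α) (y : α ⊕ α) :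
    2 ∣ minimalPeriod (Perm.sumCongr g h * sumComm α α : Perm (α ⊕ α)) y := by
  set f : Perm (α ⊕ α) := Perm.sumCongr g h * sumComm α α with hf
  have hside : Semiconj Sum.isLeft f Bool.not := by rintro (i | i) <;> simp [hf]
  have hper := (isPeriodicPt_minimalPeriod f y).map hside
  by_contra hodd
  rw [← even_iff_two_dvd, Nat.not_even_iff_odd] at hodd
  rw [IsPeriodicPt, IsFixedPt, Bool.involutive_not.iterate_odd hodd] at hper
  exact Bool.not_ne_self _ hper

theorem minimalPeriod_sumCongr_mul_sumComm_inl (g h : Perm α) (i : α) :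
    minimalPeriod (Perm.sumCongr g h * sumComm α α : Perm (α ⊕ α)) (.inl i) =
      2 * minimalPeriod (g * h) i := by
  set f : Perm (α ⊕ α) := Perm.sumCongr g h * sumComm α α with hf
  have hsq : minimalPeriod f^[2] (.inl i) = minimalPeriod (g * h) i :=
    minimalPeriod_eq_of_semiconj Sum.inl_injective (fun i => by simp [hf]) i
  have h2 : 2 ∣ minimalPeriod f (.inl i) := two_dvd_minimalPeriod_sumCongr_mul_sumComm g h _
  rw [← hsq, minimalPeriod_iterate_eq_div_gcd two_ne_zero, Nat.gcd_eq_right h2,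
    Nat.mul_div_cancel' h2]

theorem minimalPeriod_sumCongr_mul_sumComm_inr (g h : Perm α) (i : α) :
    minimalPeriod (Perm.sumCongr g h * sumComm α α : Perm (α ⊕ α)) (.inr i) =
      2 * minimalPeriod (g * h) (g i) := by
  set f : Perm (α ⊕ α) := Perm.sumCongr g h * sumComm α α with hf
  have hfi : f (.inr i) = .inl (g i) := by simp [hf]
  rw [← minimalPeriod_sumCongr_mul_sumComm_inl, ← hf, ← hfi]
  exact (minimalPeriod_eq_of_semiconj f.injective (fun _ => rfl) _).symm

theorem card_filter_sum [Fintype α] [Fintype β] (p : α ⊕ β → Prop) [DecidablePred p] :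
    #{y | p y} = #{i | p (.inl i)} + #{j | p (.inr j)} := by
  simp only [card_filter, Fintype.sum_sum_type]

variable [Fintype α] [DecidableEq α] [Fintype β] [DecidableEq β]

theorem minimalPeriod_eq_card_support_cycleOf (f : Perm α) {y : α} (hy : f y ≠ y) :
    minimalPeriod f y = #(f.cycleOf y).support := by
  have hc : (f.cycleOf y).IsCycle := Perm.isCycle_cycleOf f hy
  refine Nat.dvd_right_iff_eq.1 fun k => ?_
  rw [← isPeriodicPt_iff_minimalPeriod_dvd, ← hc.orderOf, orderOf_dvd_iff_pow_eq_one,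
    hc.pow_eq_one_iff' (x := y) (by rwa [Perm.cycleOf_apply_self]), Perm.cycleOf_pow_apply_self,
    IsPeriodicPt, IsFixedPt, Perm.iterate_eq_pow]

theorem mem_support_of_one_lt_minimalPeriod {f : Perm α} {y : α} (hy : 1 < minimalPeriod f y) :
    y ∈ f.support :=
  Perm.mem_support.2 fun h => hy.ne' (minimalPeriod_eq_one_iff_isFixedPt.2 h)

theorem filter_minimalPeriod_eq_biUnion_support (f : Perm α) {k : ℕ} (hk : 1 < k) :
    ({y | minimalPeriod f y = k} : Finset α) =
      {c ∈ f.cycleFactorsFinset | k = #c.support}.biUnion Perm.support := by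
  ext y
  simp only [mem_biUnion, mem_filter, mem_univ, true_and]
  constructor
  · rintro rfl
    have hy := mem_support_of_one_lt_minimalPeriod hk
    exact ⟨f.cycleOf y, ⟨Perm.cycleOf_mem_cycleFactorsFinset_iff.2 hy,
      minimalPeriod_eq_card_support_cycleOf f (Perm.mem_support.1 hy)⟩,
      Perm.mem_support_cycleOf_iff.2 ⟨.refl f y, hy⟩⟩
  · rintro ⟨c, ⟨hc, rfl⟩, hy⟩
    have hfy := Perm.mem_support.1 (Perm.mem_cycleFactorsFinset_support_le hc hy)
    rw [minimalPeriod_eq_card_support_cycleOf f hfy, Perm.cycle_is_cycleOf hy hc]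

theorem card_filter_minimalPeriod_eq (f : Perm α) (k : ℕ) :
    #{y | minimalPeriod f y = k} = k * f.partition.parts.count k := by
  rw [Perm.parts_partition, Multiset.count_add, Multiset.count_replicate]
  rcases Nat.lt_trichotomy k 1 with hk | rfl | hk
  · obtain rfl : k = 0 := by omega
    rw [zero_mul, card_eq_zero, filter_eq_empty_iff]
    exact fun y _ => (minimalPeriod_pos_of_mem_periodicPts (f.injective.mem_periodicPts y)).ne'
  · have no_one : f.cycleType.count 1 = 0 :=
      Multiset.count_eq_zero.2 fun h => (Perm.one_lt_of_mem_cycleType h).false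
    rw [no_one, if_pos rfl, zero_add, one_mul, ← card_compl]
    congr 1
    ext y
    rw [mem_filter_univ, minimalPeriod_eq_one_iff_isFixedPt, mem_compl, Perm.notMem_support,
      IsFixedPt]
  · rw [filter_minimalPeriod_eq_biUnion_support f hk, card_biUnion, if_neg hk.ne, add_zero,
      Perm.cycleType_def, Multiset.count_map, mul_comm]
    · exact sum_const_nat fun c hc => (mem_filter.1 hc).2.symm
    · exact fun c hc d hd hcd => (f.cycleFactorsFinset_pairwise_disjoint (mem_filter.1 hc).1
        (mem_filter.1 hd).1 hcd).disjoint_support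

theorem zero_notMem_parts_partition (f : Perm α) : 0 ∉ f.partition.parts :=
  fun h => (f.partition.parts_pos h).false

theorem parts_partition_eq_of_card_filter_minimalPeriod (f : Perm α) {s : Multiset ℕ}
    (h0 : 0 ∉ s) (h : ∀ k, #{y | minimalPeriod f y = k} = k * s.count k) :
    f.partition.parts = s := by
  ext k
  rcases Nat.eq_zero_or_pos k with rfl | hk
  · rw [Multiset.count_eq_zero.2 h0, Multiset.count_eq_zero.2 (zero_notMem_parts_partition f)]
  · exact Nat.eq_of_mul_eq_mul_left hk ((card_filter_minimalPeriod_eq f k).symm.trans (h k))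

theorem parts_partition_permCongr (e : α ≃ β) (f : Perm α) :
    (e.permCongr f).partition.parts = f.partition.parts := by
  refine parts_partition_eq_of_card_filter_minimalPeriod _ (zero_notMem_parts_partition f)
    fun k => ?_
  have hmp : ∀ y, minimalPeriod (e.permCongr f) (e y) = minimalPeriod f y :=
    minimalPeriod_eq_of_semiconj e.injective fun y => by simp
  rw [← card_filter_minimalPeriod_eq]
  exact (card_equiv e fun y => by rw [mem_filter_univ, mem_filter_univ, hmp]).symm

theorem parts_partition_sumCongr (g : Perm α) (h : Perm β) :
    (Perm.sumCongr g h).partition.parts = g.partition.parts + h.partition.parts := by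
  refine parts_partition_eq_of_card_filter_minimalPeriod _ ?_ fun k => ?_
  · simp only [Multiset.mem_add, zero_notMem_parts_partition, or_self, not_false_eq_true]
  have hl : ∀ i, minimalPeriod (Perm.sumCongr g h) (.inl i) = minimalPeriod g i :=
    minimalPeriod_eq_of_semiconj Sum.inl_injective fun i => by simp
  have hr : ∀ j, minimalPeriod (Perm.sumCongr g h) (.inr j) = minimalPeriod h j :=
    minimalPeriod_eq_of_semiconj Sum.inr_injective fun j => by simp
  rw [card_filter_sum, Multiset.count_add, mul_add]
  simp only [hl, hr, card_filter_minimalPeriod_eq]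

theorem parts_partition_sumCongr_mul_sumComm (g h : Perm α) :
    (Perm.sumCongr g h * sumComm α α : Perm (α ⊕ α)).partition.parts =
      (g * h).partition.parts.map (2 * ·) := by
  refine parts_partition_eq_of_card_filter_minimalPeriod _ ?_ fun k => ?_
  · rw [Multiset.mem_map]
    rintro ⟨k, hk, hk0⟩
    exact ((g * h).partition.parts_pos hk).ne' (by omega)
  have hcard : #{i | 2 * minimalPeriod (g * h) (g i) = k} =
      #{i | 2 * minimalPeriod (g * h) i = k} :=
    card_equiv g fun i => by rw [mem_filter_univ, mem_filter_univ]
  rw [card_filter_sum]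
  simp only [minimalPeriod_sumCongr_mul_sumComm_inl, minimalPeriod_sumCongr_mul_sumComm_inr]
  rw [hcard, ← two_mul]
  rcases Nat.even_or_odd' k with ⟨k, rfl | rfl⟩
  · rw [Multiset.count_map_eq_count' _ _ (mul_right_injective₀ two_ne_zero), mul_assoc,
      ← card_filter_minimalPeriod_eq]
    simp only [mul_right_inj' (two_ne_zero' ℕ)]
  · rw [filter_false_of_mem fun i _ => by omega, Multiset.count_eq_zero.2, card_empty]
    · simp only [mul_zero]
    · rw [Multiset.mem_map]
      rintro ⟨j, -, hj⟩
      omega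

end CycleType

/-! ### The two halves of the tree -/

section Halves

/-- The leaves of `T_{n+1}` as the disjoint union of the leaves of its left and right halves. -/
def leafEquiv (n : ℕ) : Fin (2 ^ n) ⊕ Fin (2 ^ n) ≃ Fin (2 ^ (n + 1)) :=
  finSumFinEquiv.trans (finCongr (by rw [pow_succ, mul_two]))

theorem leafEquiv_inl (n : ℕ) (i : Fin (2 ^ n)) : (leafEquiv n (.inl i) : ℕ) = i := by
  simp [leafEquiv]

theorem leafEquiv_inr (n : ℕ) (i : Fin (2 ^ n)) : (leafEquiv n (.inr i) : ℕ) = i + 2 ^ n := by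
  simp [leafEquiv]

theorem perm_ext_leafEquiv {n : ℕ} {f g : Perm (Fin (2 ^ (n + 1)))}
    (hl : ∀ i, f (leafEquiv n (.inl i)) = g (leafEquiv n (.inl i)))
    (hr : ∀ i, f (leafEquiv n (.inr i)) = g (leafEquiv n (.inr i))) : f = g :=
  Equiv.ext <| (leafEquiv n).forall_congr_right.1 <| Sum.forall.2 ⟨hl, hr⟩

/-- The action on the leaves of `T_{n+1}` of a pair of permutations of the leaves of its halves. -/
def pairHom (n : ℕ) : Perm (Fin (2 ^ n)) × Perm (Fin (2 ^ n)) →* Perm (Fin (2 ^ (n + 1))) :=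
  ((leafEquiv n).permCongrHom : _ →* _).comp (Perm.sumCongrHom _ _)

theorem pairHom_eq_permCongr {n : ℕ} (g h : Perm (Fin (2 ^ n))) :
    pairHom n (g, h) = (leafEquiv n).permCongr (Perm.sumCongr g h) :=
  rfl

@[simp]
theorem pairHom_apply_inl {n : ℕ} (g h : Perm (Fin (2 ^ n))) (i : Fin (2 ^ n)) :
    pairHom n (g, h) (leafEquiv n (.inl i)) = leafEquiv n (.inl (g i)) := by
  simp [pairHom_eq_permCongr]

@[simp]
theorem pairHom_apply_inr {n : ℕ} (g h : Perm (Fin (2 ^ n))) (i : Fin (2 ^ n)) :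
    pairHom n (g, h) (leafEquiv n (.inr i)) = leafEquiv n (.inr (h i)) := by
  simp [pairHom_eq_permCongr]

theorem pairHom_mul_pairHom {n : ℕ} (g h g' h' : Perm (Fin (2 ^ n))) :
    pairHom n (g, h) * pairHom n (g', h') = pairHom n (g * g', h * h') :=
  (map_mul (pairHom n) (g, h) (g', h')).symm

theorem a_apply {n i : ℕ} (h1 : 1 ≤ i) (hi : i ≤ n) (j : Fin (2 ^ n)) :
    (a n i j : ℕ) = swapHalves (2 ^ (i - 1)) j := by
  rw [a, dif_pos ⟨h1, hi⟩]; rfl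

theorem a_top_eq_permCongr (n : ℕ) :
    a (n + 1) (n + 1) = (leafEquiv n).permCongr (sumComm _ _) := by
  refine perm_ext_leafEquiv (fun i => Fin.ext ?_) fun i => Fin.ext ?_ <;>
    rw [a_apply (Nat.le_add_left 1 n) le_rfl, Nat.add_sub_cancel, permCongr_apply, symm_apply_apply,
      sumComm_apply, swapHalves]
  · rw [leafEquiv_inl, if_pos i.isLt, Sum.swap_inl, leafEquiv_inr]
  · have := i.isLt
    rw [leafEquiv_inr, if_neg (by omega), if_pos (by omega), Nat.add_sub_cancel, Sum.swap_inr,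
      leafEquiv_inl]

theorem a_top_mul_self (n : ℕ) : a (n + 1) (n + 1) * a (n + 1) (n + 1) = 1 := by
  rw [a_top_eq_permCongr]
  exact perm_ext_leafEquiv (by simp) (by simp)

theorem a_top_mul_pairHom {n : ℕ} (g h : Perm (Fin (2 ^ n))) :
    a (n + 1) (n + 1) * pairHom n (g, h) = pairHom n (h, g) * a (n + 1) (n + 1) := by
  rw [a_top_eq_permCongr]
  exact perm_ext_leafEquiv (by simp) (by simp)

theorem cycles_pairHom {n : ℕ} (g h : Perm (Fin (2 ^ n))) :
    cycles (pairHom n (g, h)) = cycles g + cycles h := by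
  rw [cycles, pairHom_eq_permCongr, parts_partition_permCongr, parts_partition_sumCongr, cycles,
    cycles]

theorem cycles_pairHom_mul_a_top {n : ℕ} (g h : Perm (Fin (2 ^ n))) :
    cycles (pairHom n (g, h) * a (n + 1) (n + 1)) = (cycles (g * h)).map (2 * ·) := by
  rw [cycles, pairHom_eq_permCongr, a_top_eq_permCongr, ← permCongr_mul, parts_partition_permCongr,
    parts_partition_sumCongr_mul_sumComm, cycles]

theorem a_succ {n i : ℕ} (hi : i ≤ n) : a (n + 1) i = pairHom n (a n i, 1) := by
  rcases Nat.eq_zero_or_pos i with rfl | h1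
  · rw [a, dif_neg (by omega), a, dif_neg (by omega)]
    exact (map_one (pairHom n)).symm
  have h2 : 2 * 2 ^ (i - 1) ≤ 2 ^ n := by
    rw [← pow_succ']; exact Nat.pow_le_pow_right two_pos (by omega)
  refine perm_ext_leafEquiv (fun j => Fin.ext ?_) fun j => Fin.ext ?_
  · rw [pairHom_apply_inl, leafEquiv_inl, a_apply h1 hi, a_apply h1 (by omega), leafEquiv_inl]
  · rw [pairHom_apply_inr, a_apply h1 (by omega), leafEquiv_inr, swapHalves, if_neg (by omega),
      if_neg (by omega), Perm.one_apply, leafEquiv_inr]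

theorem x_succ_right (n i : ℕ) : x n (i + 1) = x n i * a n (i + 1) := by
  simp [x, List.range_succ]

theorem x_succ {n i : ℕ} (hi : i ≤ n) : x (n + 1) i = pairHom n (x n i, 1) := by
  induction i with
  | zero => exact (map_one (pairHom n)).symm
  | succ i ih =>
    rw [x_succ_right, x_succ_right, ih (by omega), a_succ hi, pairHom_mul_pairHom, mul_one]

theorem x_top (n : ℕ) : x (n + 1) (n + 1) = pairHom n (x n n, 1) * a (n + 1) (n + 1) := by
  rw [x_succ_right, x_succ le_rfl]

theorem x_top_mul_a_top (n : ℕ) :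
    x (n + 1) (n + 1) * a (n + 1) (n + 1) = pairHom n (x n n, 1) := by
  rw [x_top, mul_assoc, a_top_mul_self, mul_one]

theorem x_top_sq (n : ℕ) : x (n + 1) (n + 1) ^ 2 = pairHom n (x n n, x n n) := by
  rw [sq, x_top, mul_assoc, ← mul_assoc (a _ _), a_top_mul_pairHom, mul_assoc, a_top_mul_self,
    mul_one, pairHom_mul_pairHom, mul_one, one_mul]

theorem x_top_conj_pairHom {n : ℕ} (g h : Perm (Fin (2 ^ n))) :
    x (n + 1) (n + 1) * pairHom n (g, h) * (x (n + 1) (n + 1))⁻¹ =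
      pairHom n (x n n * h * (x n n)⁻¹, g) := by
  rw [mul_inv_eq_iff_eq_mul, x_top, mul_assoc, a_top_mul_pairHom, ← mul_assoc, ← mul_assoc,
    pairHom_mul_pairHom, pairHom_mul_pairHom, inv_mul_cancel_right, one_mul, mul_one]

theorem v_succ {n i : ℕ} (hi : i + 2 ≤ n) : v (n + 1) i = pairHom n (v n i, 1) := by
  rw [v, v, x_succ hi, ← map_pow, Prod.pow_mk, one_pow]

theorem m_succ (n : ℕ) : m (n + 1) = pairHom n (a n n, x n n * a n n) := by
  cases n with
  | zero => exact (map_one (pairHom 0)).symm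
  | succ n =>
    rw [m, a_succ le_rfl, x_succ n.le_succ, x_top_conj_pairHom, pairHom_mul_pairHom, mul_one,
      mul_inv_cancel, mul_one, one_mul, x_succ le_rfl, x_top_mul_a_top]

end Halves

/-! ### Tree automorphisms -/

section TreeAut

theorem swapHalves_mul_div (h j : ℕ) {d : ℕ} (hd : 0 < d) :
    swapHalves (h * d) j / d = swapHalves h (j / d) := by
  simp only [swapHalves, ← mul_assoc, ← Nat.div_lt_iff_lt_mul hd]
  split_ifs
  · rw [Nat.add_mul_div_right _ _ hd]
  · rw [mul_comm h, Nat.sub_mul_div]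
  · rfl

theorem swapHalves_div_of_two_mul_le (j : ℕ) {h d : ℕ} (hd : 2 * h ≤ d) :
    swapHalves h j / d = j / d := by
  unfold swapHalves
  split_ifs
  · rw [Nat.div_eq_of_lt (by omega), Nat.div_eq_of_lt (by omega)]
  · rw [Nat.div_eq_of_lt (by omega), Nat.div_eq_of_lt (by omega)]
  · rfl

theorem a_mem_treeAut (n i : ℕ) : a n i ∈ treeAut n := by
  by_cases hi : 1 ≤ i ∧ i ≤ n
  · intro k j j'
    rw [a_apply hi.1 hi.2, a_apply hi.1 hi.2]
    rcases Nat.lt_or_ge k i with hk | hk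
    · obtain ⟨l, rfl⟩ : ∃ l, i = l + k + 1 := ⟨i - k - 1, by omega⟩
      rw [Nat.add_sub_cancel, pow_add, swapHalves_mul_div _ _ (by positivity),
        swapHalves_mul_div _ _ (by positivity)]
      exact (Function.LeftInverse.injective (swapHalves_swapHalves _)).eq_iff
    · have hle : 2 * 2 ^ (i - 1) ≤ 2 ^ k := by
        rw [← pow_succ']; exact Nat.pow_le_pow_right two_pos (by omega)
      rw [swapHalves_div_of_two_mul_le _ hle, swapHalves_div_of_two_mul_le _ hle]
  · rw [a, dif_neg hi]
    exact one_mem _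

theorem x_mem_treeAut (n i : ℕ) : x n i ∈ treeAut n :=
  list_prod_mem fun g hg => by
    obtain ⟨k, -, rfl⟩ := List.mem_map.1 hg
    exact a_mem_treeAut n _

theorem m_mem_treeAut : ∀ n : ℕ, m n ∈ treeAut n
  | 0 => one_mem _
  | 1 => one_mem _
  | _ + 2 => mul_mem (a_mem_treeAut _ _) (mul_mem (mul_mem (x_mem_treeAut _ _) (x_mem_treeAut _ _))
      (inv_mem (x_mem_treeAut _ _)))

theorem M_le_treeAut (n : ℕ) : M n ≤ treeAut n := by
  rw [M, Subgroup.closure_le]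
  rintro g ((rfl | rfl) | ⟨i, -, rfl⟩)
  exacts [x_mem_treeAut n n, m_mem_treeAut n, pow_mem (x_mem_treeAut n _) 2]

end TreeAut

/-! ### Uniform distributions in a group algebra -/

section GroupAlgebra

open MonoidAlgebra (of mapDomainAlgHom)

variable {R : Type*} [CommSemiring R]

theorem mapDomainAlgHom_of {M N : Type*} [Monoid M] [Monoid N] (φ : M →* N) (g : M) :
    mapDomainAlgHom R R φ (of R M g) = of R N (φ g) := by
  simp

theorem commute_mapDomainAlgHom {M N P : Type*} [Monoid M] [Monoid N] [Monoid P] {φ : M →* P}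
    {ψ : N →* P} (h : ∀ g k, Commute (φ g) (ψ k)) (A : MonoidAlgebra R M) (B : MonoidAlgebra R N) :
    Commute (mapDomainAlgHom R R φ A) (mapDomainAlgHom R R ψ B) := by
  induction A using MonoidAlgebra.induction_on with
  | of g =>
    induction B using MonoidAlgebra.induction_on with
    | of k => rw [mapDomainAlgHom_of, mapDomainAlgHom_of]; exact (h g k).map _
    | add B C hB hC => rw [map_add]; exact hB.add_right hC
    | smul r B hB => rw [map_smul]; exact hB.smul_right r
  | add A C hA hC => rw [map_add]; exact hA.add_left hC
  | smul r A hA => rw [map_smul]; exact hA.smul_left r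

section Augmentation

variable (R) (M : Type*) [Monoid M]

/-- The augmentation `∑ r_g g ↦ ∑ r_g`: the total mass of a distribution on `M`. -/
def augmentation : MonoidAlgebra R M →ₐ[R] R :=
  MonoidAlgebra.lift R R M 1

variable {R M}

theorem augmentation_of (g : M) : augmentation R M (of R M g) = 1 :=
  MonoidAlgebra.lift_of 1 g

theorem augmentation_eq_sum {A : MonoidAlgebra R M} {s : Finset M} (hs : A.coeff.support ⊆ s) :
    augmentation R M A = ∑ g ∈ s, A.coeff g := by
  rw [augmentation, MonoidAlgebra.lift_apply, Finsupp.sum_of_support_subset _ hs _ (by simp)]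
  simp

theorem augmentation_mapDomainAlgHom {N : Type*} [Monoid N] (φ : M →* N) (A : MonoidAlgebra R M) :
    augmentation R N (mapDomainAlgHom R R φ A) = augmentation R M A := by
  have h : (augmentation R N).comp (mapDomainAlgHom R R φ) = augmentation R M :=
    MonoidAlgebra.algHom_ext (fun g => by simp [augmentation]) (by ext)
  exact DFunLike.congr_fun h A

end Augmentation

section SupportedIn

variable {G G' : Type*} [Group G] [Group G']

variable (R) in
/-- The elements of the group algebra of `G` that are supported in the subgroup `H`. -/
def supportedIn (H : Subgroup G) : Subalgebra R (MonoidAlgebra R G) :=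
  (mapDomainAlgHom R R H.subtype).range

theorem of_mem_supportedIn {H : Subgroup G} {g : G} (hg : g ∈ H) : of R G g ∈ supportedIn R H :=
  ⟨of R H ⟨g, hg⟩, mapDomainAlgHom_of _ _⟩

theorem coeff_eq_zero_of_mem_supportedIn {H : Subgroup G} {A : MonoidAlgebra R G}
    (hA : A ∈ supportedIn R H) {g : G} (hg : g ∉ H) : A.coeff g = 0 := by
  obtain ⟨B, rfl⟩ := hA
  exact Finsupp.mapDomain_of_notMem_range _ _ (by simpa using hg)

theorem supportedIn_le {H : Subgroup G} {S : Subalgebra R (MonoidAlgebra R G)}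
    (h : ∀ g ∈ H, of R G g ∈ S) : supportedIn R H ≤ S := by
  rintro _ ⟨B, rfl⟩
  change mapDomainAlgHom R R H.subtype B ∈ S
  induction B using MonoidAlgebra.induction_on with
  | of g => rw [mapDomainAlgHom_of]; exact h g g.2
  | add A B hA hB => rw [map_add]; exact add_mem hA hB
  | smul r A hA => rw [map_smul]; exact S.smul_mem hA r

theorem supportedIn_mono {H K : Subgroup G} (h : H ≤ K) : supportedIn R H ≤ supportedIn R K :=
  supportedIn_le fun _ hg => of_mem_supportedIn (h hg)

theorem mapDomainAlgHom_mem_supportedIn {φ : G →* G'} {H : Subgroup G'} {A : MonoidAlgebra R G}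
    (hA : A ∈ supportedIn R (H.comap φ)) : mapDomainAlgHom R R φ A ∈ supportedIn R H :=
  supportedIn_le (S := (supportedIn R H).comap (mapDomainAlgHom R R φ))
    (fun g hg => by
      rw [Subalgebra.mem_comap, mapDomainAlgHom_of]
      exact of_mem_supportedIn hg) hA

open scoped Classical in
theorem coeff_eq_inv_card_of_invariant {K : Type*} [Field K] {H : Subgroup G} [Finite H]
    {A : MonoidAlgebra K G} (hsupp : A ∈ supportedIn K H) (hinv : ∀ g ∈ H, of K G g * A = A)
    (haug : augmentation K G A = 1) (g : G) :
    A.coeff g = if g ∈ H then (Nat.card H : K)⁻¹ else 0 := by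
  have hconst : ∀ g ∈ H, A.coeff g = A.coeff 1 := fun g hg => by
    conv_lhs => rw [← hinv g hg, MonoidAlgebra.of_apply]
    simp
  have hsub : A.coeff.support ⊆ (Set.toFinite (H : Set G)).toFinset := fun g hg => by
    rw [Set.Finite.mem_toFinset]
    by_contra hgH
    exact Finsupp.mem_support_iff.1 hg (coeff_eq_zero_of_mem_supportedIn hsupp hgH)
  split_ifs with hg
  · rw [hconst g hg]
    refine eq_inv_of_mul_eq_one_right ?_
    rw [← haug, augmentation_eq_sum hsub,
      Finset.sum_congr rfl fun g hg => hconst g ((Set.Finite.mem_toFinset _).1 hg),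
      Finset.sum_const, nsmul_eq_mul, ← Set.ncard_eq_toFinset_card _ (Set.toFinite _)]
    rfl
  · exact coeff_eq_zero_of_mem_supportedIn hsupp hg

end SupportedIn

end GroupAlgebra

/-! ### The group algebra of the wreath product -/

open MonoidAlgebra (of mapDomainAlgHom)

/-- The rational group algebra of the permutations of the leaves of `T_n`, whose elements encode
(signed) distributions of permutations. -/
abbrev GroupAlg (n : ℕ) := MonoidAlgebra ℚ (Perm (Fin (2 ^ n)))

/-- The product distribution `A ⊠ B`: independent permutations of the two halves of the leaves,
distributed according to `A` on the left and to `B` on the right. -/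
def boxProd {n : ℕ} : GroupAlg n →ₗ[ℚ] GroupAlg n →ₗ[ℚ] GroupAlg (n + 1) :=
  (LinearMap.mul ℚ (GroupAlg (n + 1))).compl₁₂
    (mapDomainAlgHom ℚ ℚ ((pairHom n).comp (.inl _ _))).toLinearMap
    (mapDomainAlgHom ℚ ℚ ((pairHom n).comp (.inr _ _))).toLinearMap

local notation:75 A:76 "⊠" B:76 => boxProd A B

theorem boxProd_apply {n : ℕ} (A B : GroupAlg n) :
    A ⊠ B = mapDomainAlgHom ℚ ℚ ((pairHom n).comp (.inl _ _)) A *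
      mapDomainAlgHom ℚ ℚ ((pairHom n).comp (.inr _ _)) B :=
  rfl

theorem of_boxProd_of {n : ℕ} (g h : Perm (Fin (2 ^ n))) :
    of ℚ _ g ⊠ of ℚ _ h = of ℚ _ (pairHom n (g, h)) := by
  rw [boxProd_apply, mapDomainAlgHom_of, mapDomainAlgHom_of, ← map_mul, MonoidHom.comp_apply,
    MonoidHom.comp_apply, ← map_mul]
  simp only [MonoidHom.inl_apply, MonoidHom.inr_apply, Prod.mk_mul_mk, mul_one, one_mul]

theorem of_boxProd_one {n : ℕ} (g : Perm (Fin (2 ^ n))) :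
    of ℚ _ g ⊠ 1 = of ℚ _ (pairHom n (g, 1)) := by
  rw [← of_boxProd_of, map_one (of ℚ _)]

theorem bilin_ext {n : ℕ} {V : Type*} [AddCommMonoid V] [Module ℚ V]
    {φ ψ : GroupAlg n →ₗ[ℚ] GroupAlg n →ₗ[ℚ] V}
    (h : ∀ g k, φ (of ℚ _ g) (of ℚ _ k) = ψ (of ℚ _ g) (of ℚ _ k)) : φ = ψ := by
  ext g k
  simpa using h g k

theorem boxProd_mul_boxProd {n : ℕ} (A B C D : GroupAlg n) :
    A ⊠ B * C ⊠ D = (A * C) ⊠ (B * D) := by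
  have hcomm : ∀ g h : Perm (Fin (2 ^ n)),
      Commute ((pairHom n).comp (.inr _ _) g) ((pairHom n).comp (.inl _ _) h) := fun g h =>
    (MonoidHom.commute_inl_inr h g).symm.map (pairHom n)
  simp only [boxProd_apply, map_mul, mul_assoc,
    (commute_mapDomainAlgHom (R := ℚ) hcomm B C).left_comm]

/-- The exchange of the two halves of the leaves. -/
def halfSwap (n : ℕ) : GroupAlg (n + 1) := of ℚ _ (a (n + 1) (n + 1))

theorem halfSwap_mul_self (n : ℕ) : halfSwap n * halfSwap n = 1 := by
  rw [halfSwap, ← map_mul, a_top_mul_self, map_one]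

theorem halfSwap_mul_boxProd {n : ℕ} (A B : GroupAlg n) :
    halfSwap n * A ⊠ B = B ⊠ A * halfSwap n := by
  have h : boxProd.compr₂ (LinearMap.mulLeft ℚ (halfSwap n)) =
      boxProd.flip.compr₂ (LinearMap.mulRight ℚ (halfSwap n)) :=
    bilin_ext fun g k => by
      simp only [LinearMap.compr₂_apply, LinearMap.flip_apply, LinearMap.mulLeft_apply,
        LinearMap.mulRight_apply, of_boxProd_of, halfSwap, ← map_mul, a_top_mul_pairHom]
  exact LinearMap.congr_fun₂ h A B

theorem boxProd_mul_halfSwap_mul_boxProd {n : ℕ} (A B C D : GroupAlg n) :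
    A ⊠ B * halfSwap n * C ⊠ D = (A * D) ⊠ (B * C) * halfSwap n := by
  rw [mul_assoc, halfSwap_mul_boxProd, ← mul_assoc, boxProd_mul_boxProd]

theorem boxProd_mul_boxProd_mul_halfSwap {n : ℕ} (A B C D : GroupAlg n) :
    A ⊠ B * (C ⊠ D * halfSwap n) = (A * C) ⊠ (B * D) * halfSwap n := by
  rw [← mul_assoc, boxProd_mul_boxProd]

theorem boxProd_mul_halfSwap_mul_boxProd_mul_halfSwap {n : ℕ} (A B C D : GroupAlg n) :
    A ⊠ B * halfSwap n * (C ⊠ D * halfSwap n) = (A * D) ⊠ (B * C) := by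
  rw [← mul_assoc, boxProd_mul_halfSwap_mul_boxProd, mul_assoc, halfSwap_mul_self, mul_one]

theorem augmentation_boxProd {n : ℕ} (A B : GroupAlg n) :
    augmentation ℚ _ (A ⊠ B) = augmentation ℚ _ A * augmentation ℚ _ B := by
  rw [boxProd_apply, map_mul, augmentation_mapDomainAlgHom, augmentation_mapDomainAlgHom]

theorem augmentation_halfSwap (n : ℕ) : augmentation ℚ _ (halfSwap n) = 1 :=
  augmentation_of _

theorem boxProd_mem_supportedIn {n : ℕ} {H : Subgroup (Perm (Fin (2 ^ (n + 1))))}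
    {A B : GroupAlg n} (hA : A ∈ supportedIn ℚ (H.comap ((pairHom n).comp (.inl _ _))))
    (hB : B ∈ supportedIn ℚ (H.comap ((pairHom n).comp (.inr _ _)))) :
    A ⊠ B ∈ supportedIn ℚ H :=
  mul_mem (mapDomainAlgHom_mem_supportedIn hA) (mapDomainAlgHom_mem_supportedIn hB)

/-! ### The distributions behind the four factor types -/

/-- The Klein four-group structure on the factor types, with identity `ss`. -/
def FactorType.mul : FactorType → FactorType → FactorType
  | .ss, t => t
  | t, .ss => t
  | .nn, .nn | .ns, .ns | .sn, .sn => .ss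
  | .nn, .ns | .ns, .nn => .sn
  | .nn, .sn | .sn, .nn => .ns
  | .ns, .sn | .sn, .ns => .nn

/-- The distribution of permutations of the leaves of `T_n` that stands for a factor type.
For `n ≥ 2` these are the uniform distributions on the four cosets of a normal subgroup of
`⟨x_n, a_n, v_{n-2}, …, v_0⟩` with Klein four-group quotient: the subgroup is `ss`, while `x_n` lies
in `nn` and `a_n` in `ns`. -/
def typeDist : (n : ℕ) → FactorType → GroupAlg n
  | 0, _ => 1
  | n + 1, .ss =>
    (1 / 2 : ℚ) • (typeDist n .ss ⊠ typeDist n .ss + typeDist n .nn ⊠ typeDist n .nn)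
  | n + 1, .nn =>
    (1 / 2 : ℚ) • ((typeDist n .nn ⊠ typeDist n .ss + typeDist n .ss ⊠ typeDist n .nn) * halfSwap n)
  | n + 1, .ns =>
    (1 / 2 : ℚ) • ((typeDist n .ss ⊠ typeDist n .ss + typeDist n .nn ⊠ typeDist n .nn) * halfSwap n)
  | n + 1, .sn =>
    (1 / 2 : ℚ) • (typeDist n .nn ⊠ typeDist n .ss + typeDist n .ss ⊠ typeDist n .nn)

theorem typeDist_mul_typeDist (n : ℕ) (t u : FactorType) :
    typeDist n t * typeDist n u = typeDist n (t.mul u) := by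
  induction n generalizing t u with
  | zero => exact one_mul 1
  | succ n ih =>
    cases t <;> cases u <;>
    · simp only [typeDist, FactorType.mul, smul_mul_smul_comm, mul_add, add_mul,
        boxProd_mul_boxProd, boxProd_mul_boxProd_mul_halfSwap, boxProd_mul_halfSwap_mul_boxProd,
        boxProd_mul_halfSwap_mul_boxProd_mul_halfSwap, ih]
      module

theorem of_mul_typeDist {n : ℕ} {g : Perm (Fin (2 ^ n))} {u : FactorType}
    (h : of ℚ _ g * typeDist n .ss = typeDist n u) (t : FactorType) :
    of ℚ _ g * typeDist n t = typeDist n (u.mul t) := by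
  rw [← typeDist_mul_typeDist, ← h, mul_assoc, typeDist_mul_typeDist, FactorType.mul]

theorem of_x_top (n : ℕ) :
    of ℚ _ (x (n + 1) (n + 1)) = of ℚ _ (x n n) ⊠ 1 * halfSwap n := by
  rw [x_top, map_mul, of_boxProd_one, halfSwap]

theorem of_x_mul_typeDist (n : ℕ) (t : FactorType) :
    of ℚ _ (x n n) * typeDist n t = typeDist n (FactorType.nn.mul t) := by
  refine of_mul_typeDist ?_ t
  induction n with
  | zero => exact one_mul 1
  | succ n ih =>
    simp only [of_x_top, typeDist, mul_smul_comm, mul_add, boxProd_mul_halfSwap_mul_boxProd,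
      of_mul_typeDist ih, FactorType.mul, one_mul, add_mul]

theorem of_a_mul_typeDist (n : ℕ) (t : FactorType) :
    of ℚ _ (a n n) * typeDist n t = typeDist n (FactorType.ns.mul t) := by
  refine of_mul_typeDist ?_ t
  cases n with
  | zero => exact one_mul 1
  | succ n =>
    rw [← halfSwap]
    simp only [typeDist, mul_smul_comm, mul_add, halfSwap_mul_boxProd, add_mul]

theorem of_v_mul_typeDist {n i : ℕ} (hi : i + 2 ≤ n) (t : FactorType) :
    of ℚ _ (v n i) * typeDist n t = typeDist n t := by
  refine of_mul_typeDist (u := .ss) ?_ t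
  induction n, hi using Nat.le_induction with
  | base =>
    rw [v, map_pow, sq, mul_assoc, of_x_mul_typeDist, of_x_mul_typeDist]
    rfl
  | succ n hi ih =>
    rw [v_succ hi, ← of_boxProd_one]
    simp only [typeDist, mul_smul_comm, mul_add, boxProd_mul_boxProd, of_mul_typeDist ih,
      FactorType.mul, one_mul]

theorem augmentation_typeDist (n : ℕ) (t : FactorType) :
    augmentation ℚ _ (typeDist n t) = 1 := by
  induction n generalizing t with
  | zero => exact map_one _
  | succ n ih =>
    cases t <;>
    · simp only [typeDist, map_smul, map_add, map_mul, augmentation_boxProd,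
        augmentation_halfSwap, ih]
      norm_num

/-! ### The uniform distribution on `M_{n+1}` -/

/-- The uniform distribution on the elements of `M_{n+1}` that preserve the two halves of the
leaves. -/
def evenDist (n : ℕ) : GroupAlg (n + 1) :=
  (1 / 4 : ℚ) • (typeDist n .nn ⊠ typeDist n .nn + typeDist n .ss ⊠ typeDist n .ss +
    typeDist n .ns ⊠ typeDist n .sn + typeDist n .sn ⊠ typeDist n .ns)

/-- The uniform distribution on the elements of `M_{n+1}` that exchange the two halves of the
leaves. -/
def oddDist (n : ℕ) : GroupAlg (n + 1) :=
  (1 / 4 : ℚ) • ((typeDist n .nn ⊠ typeDist n .ss + typeDist n .ss ⊠ typeDist n .nn +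
    typeDist n .ns ⊠ typeDist n .ns + typeDist n .sn ⊠ typeDist n .sn) * halfSwap n)

/-- The uniform distribution on `M_{n+1}`. -/
def distM (n : ℕ) : GroupAlg (n + 1) := (1 / 2 : ℚ) • (evenDist n + oddDist n)

theorem augmentation_distM (n : ℕ) : augmentation ℚ _ (distM n) = 1 := by
  simp only [distM, evenDist, oddDist, map_smul, map_add, map_mul, augmentation_boxProd,
    augmentation_halfSwap, augmentation_typeDist]
  norm_num

theorem of_x_mul_evenDist (n : ℕ) : of ℚ _ (x (n + 1) (n + 1)) * evenDist n = oddDist n := by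
  simp only [evenDist, oddDist, of_x_top, mul_smul_comm, mul_add, add_mul,
    boxProd_mul_halfSwap_mul_boxProd, of_x_mul_typeDist, FactorType.mul, one_mul]
  module

theorem of_x_mul_oddDist (n : ℕ) : of ℚ _ (x (n + 1) (n + 1)) * oddDist n = evenDist n := by
  simp only [evenDist, oddDist, of_x_top, mul_smul_comm, mul_add, add_mul,
    boxProd_mul_halfSwap_mul_boxProd_mul_halfSwap, of_x_mul_typeDist, FactorType.mul, one_mul]
  module

theorem of_m_succ (n : ℕ) :
    of ℚ _ (m (n + 1)) = of ℚ _ (a n n) ⊠ (of ℚ _ (x n n) * of ℚ _ (a n n)) := by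
  rw [m_succ, ← map_mul, of_boxProd_of]

theorem of_m_mul_evenDist (n : ℕ) : of ℚ _ (m (n + 1)) * evenDist n = evenDist n := by
  simp only [evenDist, of_m_succ, mul_smul_comm, mul_add, boxProd_mul_boxProd, mul_assoc,
    of_a_mul_typeDist, of_x_mul_typeDist, FactorType.mul]
  module

theorem of_m_mul_oddDist (n : ℕ) : of ℚ _ (m (n + 1)) * oddDist n = oddDist n := by
  simp only [oddDist, of_m_succ, mul_smul_comm, mul_add, add_mul,
    boxProd_mul_boxProd_mul_halfSwap, mul_assoc, of_a_mul_typeDist, of_x_mul_typeDist,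
    FactorType.mul]
  module

theorem of_v_mul_evenDist {n i : ℕ} (hi : i + 2 ≤ n) :
    of ℚ _ (v (n + 1) i) * evenDist n = evenDist n := by
  simp only [evenDist, v_succ hi, ← of_boxProd_one, mul_smul_comm, mul_add, boxProd_mul_boxProd,
    of_v_mul_typeDist hi, one_mul]

theorem of_v_mul_oddDist {n i : ℕ} (hi : i + 2 ≤ n) :
    of ℚ _ (v (n + 1) i) * oddDist n = oddDist n := by
  simp only [oddDist, v_succ hi, ← of_boxProd_one, mul_smul_comm, mul_add, add_mul,
    boxProd_mul_boxProd_mul_halfSwap, of_v_mul_typeDist hi, one_mul]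

theorem of_mul_distM {n : ℕ} {g : Perm (Fin (2 ^ (n + 1)))} (hg : g ∈ M (n + 1)) :
    of ℚ _ g * distM n = distM n := by
  induction hg using Subgroup.closure_induction with
  | mem g hg =>
    rw [distM, mul_smul_comm, mul_add]
    rcases hg with (rfl | rfl) | ⟨i, hi, rfl⟩
    · rw [of_x_mul_evenDist, of_x_mul_oddDist, add_comm (oddDist n)]
    · rw [of_m_mul_evenDist, of_m_mul_oddDist]
    · have hi' : i + 2 ≤ n := by omega
      rw [of_v_mul_evenDist hi', of_v_mul_oddDist hi']
  | one => rw [map_one, one_mul]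
  | mul g h _ _ ihg ihh => rw [map_mul, mul_assoc, ihh, ihg]
  | inv g _ ih => rw [← ih, ← mul_assoc, ← map_mul, inv_mul_cancel, map_one, one_mul, ih]

theorem typeDist_ss_boxProd_mem_supportedIn {n : ℕ} {H : Subgroup (Perm (Fin (2 ^ (n + 1))))}
    (hss : ∀ K : Subgroup (Perm (Fin (2 ^ n))), (∀ i, i + 2 ≤ n → v n i ∈ K) →
      (∀ g ∈ K, x n n * g * (x n n)⁻¹ ∈ K) → typeDist n .ss ∈ supportedIn ℚ K)
    (hv : ∀ i, i + 2 ≤ n → v (n + 1) i ∈ H) (hxx : pairHom n (x n n, x n n) ∈ H)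
    (hx : ∀ g ∈ H, x (n + 1) (n + 1) * g * (x (n + 1) (n + 1))⁻¹ ∈ H) :
    typeDist n .ss ⊠ typeDist n .ss ∈ supportedIn ℚ H := by
  have hle : H.comap ((pairHom n).comp (.inl _ _)) ≤ H.comap ((pairHom n).comp (.inr _ _)) :=
    -- conjugation by `x_{n+1}` moves a permutation of the left half to the right half
    fun g hg => by simpa [x_top_conj_pairHom] using hx _ hg
  have hinl : typeDist n .ss ∈ supportedIn ℚ (H.comap ((pairHom n).comp (.inl _ _))) :=
    hss _ (fun i hi => by simpa [v_succ hi] using hv i hi) fun g hg => by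
      simpa [← map_mul, ← map_inv] using mul_mem (mul_mem hxx hg) (inv_mem hxx)
  exact boxProd_mem_supportedIn hinl (supportedIn_mono hle hinl)

theorem typeDist_nn_boxProd_nn (n : ℕ) :
    typeDist n .nn ⊠ typeDist n .nn =
      of ℚ _ (pairHom n (x n n, x n n)) * typeDist n .ss ⊠ typeDist n .ss := by
  rw [← of_boxProd_of, boxProd_mul_boxProd, of_x_mul_typeDist]
  rfl

theorem typeDist_ss_mem_supportedIn (n : ℕ) (H : Subgroup (Perm (Fin (2 ^ n))))
    (hv : ∀ i, i + 2 ≤ n → v n i ∈ H) (hx : ∀ g ∈ H, x n n * g * (x n n)⁻¹ ∈ H) :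
    typeDist n .ss ∈ supportedIn ℚ H := by
  induction n with
  | zero => exact one_mem _
  | succ n ih =>
    have hxx : pairHom n (x n n, x n n) ∈ H := by
      cases n with
      | zero => exact (map_one (pairHom 0)).symm ▸ one_mem H
      | succ n => rw [← x_top_sq]; exact hv n le_rfl
    have hss : typeDist n .ss ⊠ typeDist n .ss ∈ supportedIn ℚ H :=
      typeDist_ss_boxProd_mem_supportedIn ih (fun i hi => hv i (by omega)) hxx hx
    rw [typeDist, typeDist_nn_boxProd_nn]
    exact Subalgebra.smul_mem _ (add_mem hss (mul_mem (of_mem_supportedIn hxx) hss)) _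

theorem evenDist_mem_supportedIn (n : ℕ) : evenDist n ∈ supportedIn ℚ (M (n + 1)) := by
  have hx : x (n + 1) (n + 1) ∈ M (n + 1) := Subgroup.subset_closure (by simp)
  have hm : m (n + 1) ∈ M (n + 1) := Subgroup.subset_closure (by simp)
  have hv : ∀ i, i + 2 ≤ n → v (n + 1) i ∈ M (n + 1) := fun i hi =>
    Subgroup.subset_closure (.inr ⟨i, by omega, rfl⟩)
  have hxx : pairHom n (x n n, x n n) ∈ M (n + 1) := by rw [← x_top_sq]; exact pow_mem hx 2
  have hss : typeDist n .ss ⊠ typeDist n .ss ∈ supportedIn ℚ (M (n + 1)) :=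
    typeDist_ss_boxProd_mem_supportedIn (typeDist_ss_mem_supportedIn n) hv hxx
      fun g hg => mul_mem (mul_mem hx hg) (inv_mem hx)
  have hnn : typeDist n .nn ⊠ typeDist n .nn ∈ supportedIn ℚ (M (n + 1)) := by
    rw [typeDist_nn_boxProd_nn]
    exact mul_mem (of_mem_supportedIn hxx) hss
  have hns : typeDist n .ns ⊠ typeDist n .sn ∈ supportedIn ℚ (M (n + 1)) := by
    have := mul_mem (of_mem_supportedIn (R := ℚ) hm) hss
    rwa [of_m_succ, boxProd_mul_boxProd, mul_assoc, of_a_mul_typeDist, of_x_mul_typeDist] at this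
  have hsn : typeDist n .sn ⊠ typeDist n .ns ∈ supportedIn ℚ (M (n + 1)) := by
    have := mul_mem (of_mem_supportedIn (R := ℚ) hxx) hns
    rwa [← of_boxProd_of, boxProd_mul_boxProd, of_x_mul_typeDist, of_x_mul_typeDist] at this
  exact Subalgebra.smul_mem _ (add_mem (add_mem (add_mem hnn hss) hns) hsn) _

theorem distM_mem_supportedIn (n : ℕ) : distM n ∈ supportedIn ℚ (M (n + 1)) := by
  have hx : x (n + 1) (n + 1) ∈ M (n + 1) := Subgroup.subset_closure (by simp)
  have heven := evenDist_mem_supportedIn n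
  rw [distM, ← of_x_mul_evenDist]
  exact Subalgebra.smul_mem _ (add_mem heven (mul_mem (of_mem_supportedIn hx) heven)) _

open scoped Classical in
theorem coeff_distM (n : ℕ) (g : Perm (Fin (2 ^ (n + 1)))) :
    (distM n).coeff g = if g ∈ M (n + 1) then (Nat.card (M (n + 1)) : ℚ)⁻¹ else 0 :=
  coeff_eq_inv_card_of_invariant (distM_mem_supportedIn n) (fun _ => of_mul_distM)
    (augmentation_distM n) g

/-! ### Generating functions of cycle types -/

/-- Formal rational combinations of multisets of cycle lengths: generating functions of
distributions of cycle types. The product is induced by the sum of multisets. -/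
abbrev CycleAlg := AddMonoidAlgebra ℚ (Multiset ℕ)

/-- The distribution of the cycle type of a random permutation. -/
def cycleDist {n : ℕ} : GroupAlg n →ₗ[ℚ] CycleAlg where
  toFun A := .ofCoeff (A.coeff.mapDomain cycles)
  map_add' A B := by simp [Finsupp.mapDomain_add]
  map_smul' r A := by simp [Finsupp.mapDomain_smul]

theorem cycleDist_of {n : ℕ} (g : Perm (Fin (2 ^ n))) :
    cycleDist (of ℚ _ g) = .single (cycles g) 1 := by
  simp [cycleDist]

theorem cycleDist_one : cycleDist (1 : GroupAlg 0) = .single {1} 1 := by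
  rw [← map_one (of ℚ _), cycleDist_of]
  simp [cycles, Perm.parts_partition]

/-- The effect on cycle types of multiplying all cycle lengths by `d`. -/
def scale (d : ℕ) : CycleAlg →ₐ[ℚ] CycleAlg :=
  AddMonoidAlgebra.mapDomainAlgHom ℚ ℚ (Multiset.mapAddMonoidHom (d * ·))

theorem scale_single (d : ℕ) (c : Multiset ℕ) (r : ℚ) :
    scale d (.single c r) = .single (c.map (d * ·)) r := by
  simp [scale]

theorem scale_scale (d e : ℕ) (A : CycleAlg) : scale d (scale e A) = scale (e * d) A := by
  have h : (scale d).comp (scale e) = scale (e * d) := by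
    refine AddMonoidAlgebra.algHom_ext (fun c => ?_) (by ext)
    simp only [AlgHom.comp_apply, scale_single, Multiset.map_map, Function.comp_def,
      mul_left_comm d, mul_assoc]
  exact DFunLike.congr_fun h A

theorem scale_one (A : CycleAlg) : scale 1 A = A := by
  have h : scale 1 = AlgHom.id ℚ CycleAlg :=
    AddMonoidAlgebra.algHom_ext (fun c => by simp [scale_single]) (by ext)
  exact DFunLike.congr_fun h A

theorem cycleDist_boxProd {n : ℕ} (A B : GroupAlg n) :
    cycleDist (A ⊠ B) = cycleDist A * cycleDist B := by
  have h : boxProd.compr₂ cycleDist =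
      (LinearMap.mul ℚ CycleAlg).compl₁₂ (cycleDist (n := n)) cycleDist :=
    bilin_ext fun g k => by
      simp only [LinearMap.compr₂_apply, LinearMap.compl₁₂_apply, LinearMap.mul_apply',
        of_boxProd_of, cycleDist_of, cycles_pairHom, AddMonoidAlgebra.single_mul_single, one_mul]
  exact LinearMap.congr_fun₂ h A B

theorem cycleDist_boxProd_mul_halfSwap {n : ℕ} (A B : GroupAlg n) :
    cycleDist (A ⊠ B * halfSwap n) = scale 2 (cycleDist (A * B)) := by
  have h : boxProd.compr₂ (cycleDist ∘ₗ LinearMap.mulRight ℚ (halfSwap n)) =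
      (LinearMap.mul ℚ (GroupAlg n)).compr₂ ((scale 2).toLinearMap ∘ₗ cycleDist) :=
    bilin_ext fun g k => by
      simp only [LinearMap.compr₂_apply, LinearMap.comp_apply, LinearMap.mulRight_apply,
        LinearMap.mul_apply', AlgHom.toLinearMap_apply, of_boxProd_of, halfSwap, ← map_mul,
        cycleDist_of, cycles_pairHom_mul_a_top, scale_single]
  exact LinearMap.congr_fun₂ h A B

theorem cycleDist_typeDist_succ_nn (n : ℕ) :
    cycleDist (typeDist (n + 1) .nn) = scale 2 (cycleDist (typeDist n .nn)) := by
  simp only [typeDist, map_smul, map_add, add_mul, cycleDist_boxProd_mul_halfSwap,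
    typeDist_mul_typeDist, FactorType.mul]
  module

theorem cycleDist_typeDist_succ_ns (n : ℕ) :
    cycleDist (typeDist (n + 1) .ns) = scale 2 (cycleDist (typeDist n .ss)) := by
  simp only [typeDist, map_smul, map_add, add_mul, cycleDist_boxProd_mul_halfSwap,
    typeDist_mul_typeDist, FactorType.mul]
  module

theorem cycleDist_typeDist_succ_sn (n : ℕ) :
    cycleDist (typeDist (n + 1) .sn) =
      cycleDist (typeDist n .nn) * cycleDist (typeDist n .ss) := by
  simp only [typeDist, map_smul, map_add, cycleDist_boxProd,
    mul_comm (cycleDist (typeDist n .ss))]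
  module

theorem cycleDist_typeDist_succ_ss (n : ℕ) :
    cycleDist (typeDist (n + 1) .ss) = (1 / 2 : ℚ) •
      (cycleDist (typeDist n .nn) * cycleDist (typeDist n .nn) +
        cycleDist (typeDist n .ss) * cycleDist (typeDist n .ss)) := by
  simp only [typeDist, map_smul, map_add, cycleDist_boxProd]
  module

theorem cycleDist_distM (n : ℕ) :
    cycleDist (distM n) = (1 / 4 : ℚ) • scale 2 (cycleDist (typeDist n .nn)) +
      (1 / 4 : ℚ) • scale 2 (cycleDist (typeDist n .ss)) +
      (1 / 8 : ℚ) • (cycleDist (typeDist n .nn) * cycleDist (typeDist n .nn)) +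
      (1 / 8 : ℚ) • (cycleDist (typeDist n .ss) * cycleDist (typeDist n .ss)) +
      (1 / 4 : ℚ) • (cycleDist (typeDist n .ns) * cycleDist (typeDist n .sn)) := by
  simp only [distM, evenDist, oddDist, map_smul, map_add, add_mul, cycleDist_boxProd,
    cycleDist_boxProd_mul_halfSwap, typeDist_mul_typeDist, FactorType.mul,
    mul_comm (cycleDist (typeDist n .sn))]
  module

/-! ### Substitution in formal products -/

section Subst

variable {σ R A : Type*} [CommSemiring R] [CommSemiring A] [Algebra R A]

/-- The algebra homomorphism that substitutes `w s` for each factor `s` of a formal product. -/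
def substHom (w : σ → A) : AddMonoidAlgebra R (Multiset σ) →ₐ[R] A :=
  AddMonoidAlgebra.lift R A (Multiset σ)
    { toFun := fun F => (F.toAdd.map w).prod
      map_one' := by simp
      map_mul' := fun F G => by simp }

theorem substHom_apply (w : σ → A) (D : AddMonoidAlgebra R (Multiset σ)) :
    substHom w D = D.coeff.sum fun F r => r • (F.map w).prod :=
  AddMonoidAlgebra.lift_apply _ D

theorem substHom_single (w : σ → A) (F : Multiset σ) (r : R) :
    substHom w (.single F r) = r • (F.map w).prod :=
  AddMonoidAlgebra.lift_single _ F r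

theorem algHom_ext_singleton {φ ψ : AddMonoidAlgebra R (Multiset σ) →ₐ[R] A}
    (h : ∀ s, φ (.single {s} 1) = ψ (.single {s} 1)) : φ = ψ := by
  refine AddMonoidAlgebra.algHom_ext (fun F => ?_) (by ext)
  induction F using Multiset.induction with
  | empty => exact (map_one φ).trans (map_one ψ).symm
  | cons s F ih =>
    rw [← Multiset.singleton_add, ← one_mul (1 : R), ← AddMonoidAlgebra.single_mul_single, map_mul,
      map_mul, h, ih]

end Subst

/-! ### The Markov process -/

/-- The distribution of the underlying partition of a random formal product. -/
def degreeHom : LevelData →ₐ[ℚ] CycleAlg :=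
  AddMonoidAlgebra.mapDomainAlgHom ℚ ℚ (Multiset.mapAddMonoidHom Prod.snd)

/-- The distribution that a factor `[t, d]` stands for, `k` levels above the leaves: that of the
cycle lengths on the leaves below an orbit of `d` vertices whose stabilizer generator acts on the
subtree of height `k` below one of them according to `typeDist k t`. -/
def factorCycleDist (k : ℕ) (f : Factor) : CycleAlg := scale f.2 (cycleDist (typeDist k f.1))

theorem substHom_stepFactor (k : ℕ) (f : Factor) :
    substHom (factorCycleDist k) (stepFactor f) = factorCycleDist (k + 1) f := by
  obtain ⟨t, d⟩ := f
  cases t <;>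
  simp [stepFactor, transitions, factorCycleDist, substHom_single, scale_scale,
    cycleDist_typeDist_succ_nn, cycleDist_typeDist_succ_ns, cycleDist_typeDist_succ_sn,
    cycleDist_typeDist_succ_ss]

theorem degreeHom_eq_substHom : degreeHom = substHom (factorCycleDist 0) :=
  algHom_ext_singleton fun f => by
    simp [degreeHom, substHom_single, factorCycleDist, typeDist, cycleDist_one, scale_single]

theorem substHom_step (k : ℕ) (D : LevelData) :
    substHom (factorCycleDist k) (step D) = substHom (factorCycleDist (k + 1)) D := by
  have h : (substHom (factorCycleDist k)).comp (substHom stepFactor) =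
      substHom (R := ℚ) (factorCycleDist (k + 1)) :=
    algHom_ext_singleton fun f => by
      simp [substHom_single, substHom_stepFactor]
  rw [← h, AlgHom.comp_apply, substHom_apply stepFactor, step]

theorem degreeHom_iterate_step (k : ℕ) (D : LevelData) :
    degreeHom (step^[k] D) = substHom (factorCycleDist k) D := by
  induction k generalizing D with
  | zero => rw [degreeHom_eq_substHom, Function.iterate_zero_apply]
  | succ k ih => rw [Function.iterate_succ_apply, ih, substHom_step]

theorem degreeHom_levelData (k : ℕ) : degreeHom (levelData (k + 1)) = cycleDist (distM k) := by
  rw [levelData, Nat.add_sub_cancel, degreeHom_iterate_step, cycleDist_distM]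
  simp [levelOne, substHom_single, factorCycleDist, scale_one]

/-! ### Cycle data -/

theorem coeff_single_nonneg {R M : Type*} [Semiring R] [Preorder R] {r : R} (hr : 0 ≤ r)
    (m m' : M) : 0 ≤ (AddMonoidAlgebra.single m r).coeff m' :=
  Finsupp.single_nonneg.2 hr m'

/-- The elements of a monoid algebra with nonnegative coefficients. -/
def nonnegCoeff (R M : Type*) [Semiring R] [PartialOrder R] [IsOrderedRing R] [AddMonoid M] :
    Subsemiring (AddMonoidAlgebra R M) where
  carrier := {A | ∀ m, 0 ≤ A.coeff m}
  zero_mem' := fun _ => le_rfl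
  one_mem' := coeff_single_nonneg zero_le_one 0
  add_mem' := fun hA hB m => add_nonneg (hA m) (hB m)
  mul_mem' := fun {A B} hA hB m => by
    rw [AddMonoidAlgebra.mul_def, AddMonoidAlgebra.coeff_finsuppSum, Finsupp.sum_apply]
    refine Finset.sum_nonneg fun k _ => ?_
    simp only [AddMonoidAlgebra.coeff_finsuppSum, Finsupp.sum_apply]
    exact Finset.sum_nonneg fun l _ => coeff_single_nonneg (mul_nonneg (hA k) (hB l)) _ _

theorem stepFactor_mem_nonnegCoeff (f : Factor) : stepFactor f ∈ nonnegCoeff ℚ FormalProduct := by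
  refine list_sum_mem fun D hD => ?_
  obtain ⟨F, -, rfl⟩ := List.mem_map.1 hD
  exact coeff_single_nonneg (by positivity) F

theorem step_mem_nonnegCoeff {D : LevelData} (hD : D ∈ nonnegCoeff ℚ FormalProduct) :
    step D ∈ nonnegCoeff ℚ FormalProduct := by
  have hprod : ∀ F : FormalProduct, (F.map stepFactor).prod ∈ nonnegCoeff ℚ FormalProduct :=
    fun F => multiset_prod_mem _ fun E hE => by
      obtain ⟨f, -, rfl⟩ := Multiset.mem_map.1 hE
      exact stepFactor_mem_nonnegCoeff f
  exact sum_mem fun F _ G => mul_nonneg (hD F) (hprod F G)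

theorem levelData_mem_nonnegCoeff (n : ℕ) : levelData n ∈ nonnegCoeff ℚ FormalProduct := by
  rw [levelData]
  induction n - 1 with
  | zero =>
    refine add_mem (add_mem (add_mem (add_mem ?_ ?_) ?_) ?_) ?_ <;>
      exact coeff_single_nonneg (by norm_num) _
  | succ k ih => rw [Function.iterate_succ_apply']; exact step_mem_nonnegCoeff ih

theorem coe_graph_mapDomain_of_nonneg {α β K : Type*} [DecidableEq β] [AddCommMonoid K]
    [PartialOrder K] [IsOrderedCancelAddMonoid K] {f : α →₀ K} (hf : ∀ i, 0 ≤ f i) (φ : α → β) :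
    ((f.mapDomain φ).graph : Set (β × K)) = {p | ∃ i ∈ f.support, p.1 = φ i ∧
      p.2 = ∑ j ∈ f.support with φ j = φ i, f j} := by
  ext ⟨b, q⟩
  simp only [Finset.mem_coe, Finsupp.mem_graph_iff, Set.mem_ofPred_eq]
  constructor
  · rintro ⟨rfl, hq⟩
    obtain ⟨i, hi, rfl⟩ :=
      Finset.mem_image.1 (Finsupp.mapDomain_support (Finsupp.mem_support_iff.2 hq))
    exact ⟨i, hi, rfl, Finsupp.mapDomain_apply_eq_sum φ f⟩
  · rintro ⟨i, hi, rfl, rfl⟩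
    have hi_pos : 0 < f i := (hf i).lt_of_ne (Finsupp.mem_support_iff.1 hi).symm
    have hsum_pos : 0 < ∑ j ∈ f.support with φ j = φ i, f j :=
      Finset.sum_pos' (fun j _ => hf j) ⟨i, Finset.mem_filter.2 ⟨hi, rfl⟩, hi_pos⟩
    exact ⟨Finsupp.mapDomain_apply_eq_sum φ f, hsum_pos.ne'⟩

theorem toCycleData_eq_graph {D : LevelData} (hD : D ∈ nonnegCoeff ℚ FormalProduct) :
    D.toCycleData = ((degreeHom D).coeff.graph : Set (Multiset ℕ × ℚ)) :=
  (coe_graph_mapDomain_of_nonneg hD degrees).symm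

open scoped Classical in
theorem cycleData_eq_graph {n : ℕ} {H : Subgroup (Perm (Fin (2 ^ n)))} {A : GroupAlg n}
    (hA : ∀ g, A.coeff g = if g ∈ H then (Nat.card H : ℚ)⁻¹ else 0) :
    cycleData (n := n) H H = ((cycleDist A).coeff.graph : Set (Multiset ℕ × ℚ)) := by
  have hcard : (Nat.card H : ℚ) ≠ 0 := Nat.cast_ne_zero.2 Nat.card_pos.ne'
  have hsupp : ∀ g, g ∈ A.coeff.support ↔ g ∈ H := fun g => by
    rw [Finsupp.mem_support_iff, hA]
    simp
  have hnonneg : ∀ g, 0 ≤ A.coeff g := fun g => by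
    rw [hA]
    positivity
  have hsum : ∀ c, ∑ h ∈ A.coeff.support with cycles h = c, A.coeff h =
      ({h ∈ (H : Set (Perm (Fin (2 ^ n)))) | cycles h = c}.ncard : ℚ) / Nat.card H := fun c => by
    have hcoeff : ∀ h ∈ A.coeff.support.filter (cycles · = c), A.coeff h = (Nat.card H : ℚ)⁻¹ :=
      fun h hh => by rw [hA, if_pos ((hsupp h).1 (Finset.mem_filter.1 hh).1)]
    rw [Finset.sum_congr rfl hcoeff, Finset.sum_const, nsmul_eq_mul, div_eq_mul_inv,
      ← Set.ncard_coe_finset]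
    simp only [Finset.coe_filter, hsupp, SetLike.mem_coe]
  refine Eq.trans ?_ (coe_graph_mapDomain_of_nonneg hnonneg cycles).symm
  rw [cycleData]
  simp only [hsupp, hsum, ← Nat.card_coe_set_eq, SetLike.mem_coe, SetLike.coe_sort_coe,
    div_self hcard, mul_one]

theorem cycleData_M_succ (n : ℕ) :
    cycleData (n := n + 1) (M (n + 1)) (M (n + 1)) =
      ((cycleDist (distM n)).coeff.graph : Set (Multiset ℕ × ℚ)) :=
  cycleData_eq_graph (coeff_distM n)

end

end MarkovModel

theorem theoremB (n : ℕ) (hn : 1 ≤ n) :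
    MarkovModel.M n ≤ MarkovModel.treeAut n ∧
      MarkovModel.cycleData (n := n) (MarkovModel.M n) (MarkovModel.M n) =
        MarkovModel.LevelData.toCycleData (MarkovModel.levelData n) := by
  obtain ⟨k, rfl⟩ : ∃ k, n = k + 1 := ⟨n - 1, by omega⟩
  refine ⟨MarkovModel.M_le_treeAut _, ?_⟩
  rw [MarkovModel.cycleData_M_succ,
    MarkovModel.toCycleData_eq_graph (MarkovModel.levelData_mem_nonnegCoeff _),
    MarkovModel.degreeHom_levelData]
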